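/- Let $J$ be a finite set, let $f_j:\mathbb{R}^n\to\mathbb{R}$ for $j\in J$, and let $C=\{x\in\mathbb{R}^n\mid f_j(x)\le 0\text{ for all }j\in J\}$. Let $\bar x\in C$, let $J'=\{j\in J\mid f_j(\bar x)=0\}$ be the set of active indices, and suppose that every $f_j$, $j\in J$, is continuous at $\bar x$. Notation. For a set $D$ and $x\in D$, a vector $v$ is a regular normal, $v\in\hat N_D(x)$, if $v^T(y-x)\le o(|y-x|)$ for $y\in D$. For $x\in D$, a vector $v$ belongs to the normal cone $N_D(x)$ if there are $x_i\to x$ in $D$ and $v_i\to v$ with $v_i\in\hat N_D(x_i)$. The set $D$ is Clarke regular at $x$ if $N_D(x)=\hat N_D(x)$. The tangent cone $T_D(x)$ is the set of all limits $\lim_i (x_i-x)/t_i$ with $x_i\in D$, $x_i\to x$, $t_i\searrow 0$. For $f:\mathbb{R}^n\to\mathbb{R}$, $v\in\hat\partial f(x)$ means $f(y)\ge f(x)+\langle v,y-x\rangle+o(|y-x|)$, and $v\in\partial f(x)$ means that there are $x_i\to x$ and $v_i\to v$ with $f(x_i)\to f(x)$ and $v_i\in\hat\partial f(x_i)$. If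 $f$ is Lipschitz on a neighbourhood of $x$ (locally Lipschitz at $x$), it is called subdifferentially regular at $x$ if its epigraph $\{(y,t)\mid t\ge f(y)\}\subset\mathbb{R}^n\times\mathbb{R}$ is Clarke regular at $(x,f(x))$. (1) Suppose that for every $j\in J'$ the function $f_j$ is continuously differentiable at $\bar x$ (differentiable near $\bar x$, with gradient continuous at $\bar x$), and that the Mangasarian–Fromovitz constraint qualification holds at $\bar x$: there is $w\in\mathbb{R}^n$ with $\nabla f_j(\bar x)^Tw<0$ for all $j\in J'$. Then $C$ is Clarke regular at $\bar x$ and $$T_C(\bar x)=\{z\mid \nabla f_j(\bar x)^Tz\le 0\text{ for all }j\in J'\}.$$ (2) Suppose that for every $j\in J'$ the function $f_j$ is locally Lipschitz and subdifferentially regular at $\bar x$, and that $$\sum_{j\in J'}\lambda_jv_j=0,\quad v_j\in\partial f_j(\bar x)\ \text{ and }\ \lambda_j\ge 0\ \text{ for all } j\in J'$$ implies $\lambda_j=0$ for all $j\in J'$. Then $C$ is Clarke regular at $\bar x$ and $$T_C(\bar x)=\bigcap_{j\in J'}\{z\mid v^Tz\le 0\text{ for all }v\in\partial f_j(\bar x)\}=\Big\{z\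 \Big|\ v^Tz\le 0\text{ for all }v\in\bigcup_{j\in J'}\partial f_j(\bar x)\Big\}.$$ -/

import Mathlib

open Filter Topology
open scoped NNReal Gradient

section VariationalAnalysis

variable {E : Type*} [NormedAddCommGroup E] [InnerProductSpace ℝ E]

/-- The cone of regular normals to `C` at `x`: the vectors `v` such that
`⟪v, y - x⟫ ≤ o(‖y - x‖)` for `y ∈ C`. It is defined at points of `C` only,
and is empty by convention at the other points. -/
def regularNormalCone (C : Set E) (x : E) : Set E :=
  {v | x ∈ C ∧ ∀ ε : ℝ, 0 < ε → ∀ᶠ y in 𝓝[C] x, inner ℝ v (y - x) ≤ ε * ‖y - x‖}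

/-- The (general, or limiting) normal cone to `C` at `x`: the limits of regular normals to `C`
at points of `C` converging to `x`. -/
def normalCone (C : Set E) (x : E) : Set E :=
  {v | ∃ (xs vs : ℕ → E), (∀ i, vs i ∈ regularNormalCone C (xs i)) ∧
    Tendsto xs atTop (𝓝 x) ∧ Tendsto vs atTop (𝓝 v)}

/-- `C` is Clarke regular at `x`: every normal vector to `C` at `x` is a regular normal. -/
def IsClarkeRegularAt (C : Set E) (x : E) : Prop :=
  normalCone C x = regularNormalCone C x

/-- The (contingent) tangent cone to `C` at `x`. -/
def tangentCone (C : Set E) (x : E) : Set E :=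
  {w | ∃ (xs : ℕ → E) (t : ℕ → ℝ), (∀ i, xs i ∈ C) ∧ (∀ i, 0 < t i) ∧
    Tendsto t atTop (𝓝 0) ∧ Tendsto xs atTop (𝓝 x) ∧
    Tendsto (fun i => (t i)⁻¹ • (xs i - x)) atTop (𝓝 w)}

/-- The regular (Fréchet) subdifferential of `f` at `x`: the vectors `v` such that
`f y ≥ f x + ⟪v, y - x⟫ + o(‖y - x‖)`. -/
def regularSubdifferential (f : E → ℝ) (x : E) : Set E :=
  {v | ∀ ε : ℝ, 0 < ε → ∀ᶠ y in 𝓝 x, f x + inner ℝ v (y - x) - ε * ‖y - x‖ ≤ f y}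

/-- The (general, or limiting) subdifferential of `f` at `x`. -/
def subdifferential (f : E → ℝ) (x : E) : Set E :=
  {v | ∃ (xs vs : ℕ → E), (∀ i, vs i ∈ regularSubdifferential f (xs i)) ∧
    Tendsto xs atTop (𝓝 x) ∧ Tendsto (fun i => f (xs i)) atTop (𝓝 (f x)) ∧
    Tendsto vs atTop (𝓝 v)}

/-- The epigraph of `f`, in the product `E × ℝ` with the Euclidean (`L²`) inner product. -/
def epigraph (f : E → ℝ) : Set (WithLp 2 (E × ℝ)) :=
  {p | f p.fst ≤ p.snd}

/-- `f` is Lipschitz on some neighbourhood of `x`. -/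
def IsLocallyLipschitzAt (f : E → ℝ) (x : E) : Prop :=
  ∃ K : ℝ≥0, ∃ U ∈ 𝓝 x, LipschitzOnWith K f U

/-- `f` is (subdifferentially) regular at `x`: its epigraph is Clarke regular at `(x, f x)`. -/
def IsSubdifferentiallyRegularAt (f : E → ℝ) (x : E) : Prop :=
  IsClarkeRegularAt (epigraph f) (WithLp.toLp 2 (x, f x))

/-- `f` is continuously differentiable at `x`: it is differentiable near `x`, and its gradient is
continuous at `x`. -/
def IsContinuouslyDifferentiableAt [CompleteSpace E] (f : E → ℝ) (x : E) : Prop :=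
  (∀ᶠ y in 𝓝 x, DifferentiableAt ℝ f y) ∧ ContinuousAt (∇ f) x

variable {J : Type*}

/-- The feasible set `{x | f j x ≤ 0 for all j}`. -/
def feasibleSet (f : J → E → ℝ) : Set E :=
  {x | ∀ j, f j x ≤ 0}

open Classical in
/-- The indices of the constraints that are active at `x`. -/
noncomputable def activeIndices [Fintype J] (f : J → E → ℝ) (x : E) : Finset J :=
  Finset.univ.filter fun j => f j x = 0

/-- The Mangasarian-Fromovitz constraint qualification at `x` (inequality constraints only). -/
def MFCQ [CompleteSpace E] [Fintype J] (f : J → E → ℝ) (x : E) : Prop :=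
  ∃ w : E, ∀ j ∈ activeIndices f x, inner ℝ (∇ (f j) x) w < 0

/-- The nonsmooth constraint qualification at `x`: positive linear independence of the
subdifferentials of the active constraints. -/
def NonsmoothMFCQ [Fintype J] (f : J → E → ℝ) (x : E) : Prop :=
  ∀ (c : J → ℝ) (v : J → E),
    (∀ j ∈ activeIndices f x, v j ∈ subdifferential (f j) x) →
    (∀ j ∈ activeIndices f x, 0 ≤ c j) →
    ∑ j ∈ activeIndices f x, c j • v j = 0 →
    ∀ j ∈ activeIndices f x, c j = 0

end VariationalAnalysis

/-! ### Regular and limiting subgradients. -/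

section Sub

variable {E : Type*} [NormedAddCommGroup E] [InnerProductSpace ℝ E]

/-! Both parts are instances of `isClarkeRegularAt_feasibleSet_and_tangentCone_eq`, which needs a
direction `w` with `⟪v, w⟫ < 0` for all subgradients `v` of active constraints, all of them regular.
In the smooth case the only subgradient is the gradient. In the nonsmooth case epigraph regularity
makes subgradients regular, so the subdifferentials are compact and convex, and Hahn-Banach
separates 0 from their convex combinations.

The analytic core is a uniform descent estimate: if `⟪v, w⟫ < a` for all subgradients at `x`, then
`f (y + t • w) ≤ f y + a * t` for all `y` near `x` and small `t > 0`. It follows from a mean value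
inequality for quadratic inf-convolutions.

Hence, for `z` in the linearized cone and `η > 0`, the direction `z + η • w` keeps every feasible
point near `x` feasible. At `x` itself, letting `η → 0` makes `z` tangent. At nearby points it
bounds regular normals, and in the limit every normal at `x` is polar to the tangent cone, hence
regular. -/

theorem regularSubdifferential_subset_subdifferential (f : E → ℝ) (x : E) :
    regularSubdifferential f x ⊆ subdifferential f x := fun v hv =>
  ⟨fun _ => x, fun _ => v, fun _ => hv, tendsto_const_nhds, tendsto_const_nhds,
    tendsto_const_nhds⟩

theorem regularNormalCone_subset_normalCone (C : Set E) (x : E) :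
    regularNormalCone C x ⊆ normalCone C x := fun v hv =>
  ⟨fun _ => x, fun _ => v, fun _ => hv, tendsto_const_nhds, tendsto_const_nhds⟩

theorem convex_regularSubdifferential (f : E → ℝ) (x : E) :
    Convex ℝ (regularSubdifferential f x) := by
  intro v hv u hu a b ha hb hab ε hε
  filter_upwards [hv ε hε, hu ε hε] with y h1 h2
  rw [inner_add_left, real_inner_smul_left, real_inner_smul_left]
  have e : b = 1 - a := by linarith
  subst e
  nlinarith [mul_le_mul_of_nonneg_left h1 ha, mul_le_mul_of_nonneg_left h2 hb]

theorem isClosed_regularSubdifferential (f : E → ℝ) (x : E) :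
    IsClosed (regularSubdifferential f x) := by
  refine isClosed_of_closure_subset fun v hv ε hε => ?_
  obtain ⟨u, hu, huv⟩ := Metric.mem_closure_iff.1 hv (ε / 2) (half_pos hε)
  filter_upwards [hu (ε / 2) (half_pos hε)] with y hy
  have h : inner ℝ (v - u) (y - x) ≤ ε / 2 * ‖y - x‖ :=
    (real_inner_le_norm _ _).trans
      (mul_le_mul_of_nonneg_right (by rw [← dist_eq_norm]; exact huv.le) (norm_nonneg _))
  rw [inner_sub_left] at h
  linarith

/-- Along a ray, an eventual bound with arbitrarily small linear error bounds the slope. -/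
theorem le_of_eventually_mul_le {a b c : ℝ}
    (h : ∀ ε : ℝ, 0 < ε → ∀ᶠ t in 𝓝[>] (0 : ℝ), t * a ≤ t * b + ε * (t * c)) : a ≤ b := by
  have key : ∀ ε : ℝ, 0 < ε → a ≤ b + ε * c := by
    intro ε hε
    obtain ⟨t, ht, ht0⟩ := ((h ε hε).and self_mem_nhdsWithin).exists
    have ht0' : 0 < t := ht0
    by_contra! hc
    nlinarith [mul_lt_mul_of_pos_left hc ht0']
  have lim : Tendsto (fun ε : ℝ => b + ε * c) (𝓝[>] 0) (𝓝 b) := by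
    have : Tendsto (fun ε : ℝ => b + ε * c) (𝓝 0) (𝓝 (b + 0 * c)) :=
      (Continuous.tendsto (by fun_prop) 0)
    simpa using this.mono_left nhdsWithin_le_nhds
  exact ge_of_tendsto lim (eventually_mem_nhdsWithin.mono fun ε hε => key ε hε)

theorem tendsto_add_smul_nhdsWithin_zero (x h : E) (s : Set ℝ) :
    Tendsto (fun t : ℝ => x + t • h) (𝓝[s] 0) (𝓝 x) := by
  have : Tendsto (fun t : ℝ => x + t • h) (𝓝 0) (𝓝 (x + (0 : ℝ) • h)) :=
    Continuous.tendsto (by fun_prop) 0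
  simpa using this.mono_left nhdsWithin_le_nhds

/-- Along the ray in direction `v` itself, the subgradient inequality forces growth at rate `‖v‖ ^
2`, while the Lipschitz bound allows only `K * ‖v‖`. -/
theorem norm_le_of_mem_regularSubdifferential {f : E → ℝ} {K : ℝ≥0} {U : Set E} {x : E}
    (hf : LipschitzOnWith K f U) (hU : U ∈ 𝓝 x) {v : E} (hv : v ∈ regularSubdifferential f x) :
    ‖v‖ ≤ K := by
  have h : ‖v‖ * ‖v‖ ≤ K * ‖v‖ := by
    refine le_of_eventually_mul_le (c := ‖v‖) fun ε hε => ?_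
    have ht := tendsto_add_smul_nhdsWithin_zero x v (Set.Ioi 0)
    filter_upwards [ht.eventually (hv ε hε), ht.eventually hU, self_mem_nhdsWithin]
      with t h1 h2 h3
    have h3' : 0 < t := h3
    have h4 := (le_abs_self _).trans
      ((Real.dist_eq _ _).symm.le.trans (hf.dist_le_mul _ h2 _ (mem_of_mem_nhds hU)))
    rw [dist_eq_norm] at h4
    simp only [add_sub_cancel_left, norm_smul, Real.norm_of_nonneg h3'.le, inner_smul_right,
      real_inner_self_eq_norm_mul_norm] at h1 h4
    linarith
  rcases (norm_nonneg v).eq_or_lt with h0 | h0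
  · rw [← h0]; positivity
  · exact le_of_mul_le_mul_right h h0

theorem IsLocallyLipschitzAt.continuousAt {E : Type*} [NormedAddCommGroup E]
    {f : E → ℝ} {x : E} (hf : IsLocallyLipschitzAt f x) :
    ContinuousAt f x := by
  obtain ⟨K, U, hU, h⟩ := hf
  exact h.continuousOn.continuousAt hU

theorem mem_regularNormalCone_epigraph {f : E → ℝ} {x v : E}
    (hv : v ∈ regularSubdifferential f x) :
    WithLp.toLp 2 (v, (-1 : ℝ)) ∈ regularNormalCone (epigraph f) (WithLp.toLp 2 (x, f x)) := by
  refine ⟨le_refl (f x), fun ε hε => ?_⟩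
  have hfst : Tendsto (fun p : WithLp 2 (E × ℝ) => p.fst) (𝓝 (WithLp.toLp 2 (x, f x))) (𝓝 x) :=
    (WithLp.continuous_fst 2 E ℝ).tendsto (WithLp.toLp 2 (x, f x))
  filter_upwards [(hfst.eventually (hv ε hε)).filter_mono nhdsWithin_le_nhds,
    self_mem_nhdsWithin] with p h1 h2
  have h2' : f p.fst ≤ p.snd := h2
  have h3 : ‖p.fst - x‖ ≤ ‖p - WithLp.toLp 2 (x, f x)‖ :=
    WithLp.norm_fst_le _ (p - WithLp.toLp 2 (x, f x))
  have h4 := mul_le_mul_of_nonneg_left h3 hε.le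
  simp only [WithLp.prod_inner_apply, WithLp.ofLp_sub, Prod.fst_sub, Prod.snd_sub]
  simp only [RCLike.inner_apply, conj_trivial]
  change inner ℝ v (p.fst - x) + (p.snd - f x) * -1 ≤ _
  linarith

/-- Subdifferential regularity of a locally Lipschitz function makes all subgradients regular. -/
theorem IsSubdifferentiallyRegularAt.subdifferential_subset {f : E → ℝ} {x : E}
    (hf : IsLocallyLipschitzAt f x) (hreg : IsSubdifferentiallyRegularAt f x) :
    subdifferential f x ⊆ regularSubdifferential f x := by
  rintro v ⟨xs, vs, hvs, hxs, hfxs, hlim⟩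
  have hmem : WithLp.toLp 2 (v, (-1 : ℝ)) ∈
      normalCone (epigraph f) (WithLp.toLp 2 (x, f x)) :=
    ⟨fun i => WithLp.toLp 2 (xs i, f (xs i)), fun i => WithLp.toLp 2 (vs i, -1),
      fun i => mem_regularNormalCone_epigraph (hvs i),
      ((WithLp.prod_continuous_toLp 2 E ℝ).tendsto _).comp (hxs.prodMk_nhds hfxs),
      ((WithLp.prod_continuous_toLp 2 E ℝ).tendsto _).comp (hlim.prodMk_nhds tendsto_const_nhds)⟩
  rw [hreg] at hmem
  obtain ⟨-, hmem⟩ := hmem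
  intro ε hε
  have hcont := hf.continuousAt
  obtain ⟨K, U, hU, hK⟩ := hf
  have hK1 : (0 : ℝ) < 1 + K := by positivity
  have hgraph : Tendsto (fun y => WithLp.toLp 2 (y, f y)) (𝓝 x)
      (𝓝[epigraph f] (WithLp.toLp 2 (x, f x))) :=
    tendsto_nhdsWithin_iff.2
      ⟨((WithLp.prod_continuous_toLp 2 E ℝ).tendsto _).comp (tendsto_id.prodMk_nhds hcont),
        Eventually.of_forall fun y => le_refl (f y)⟩
  -- Chords of the graph have length at most `(1 + K) * ‖y - x‖`, so this tolerance on the epigraph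
  -- becomes `ε` on the base space.
  filter_upwards [hgraph.eventually (hmem (ε / (1 + K)) (by positivity)), hU] with y h1 h2
  have h3 := hK.dist_le_mul _ h2 _ (mem_of_mem_nhds hU)
  rw [dist_eq_norm, dist_eq_norm] at h3
  have h4 : ‖WithLp.toLp 2 (y, f y) - WithLp.toLp 2 (x, f x)‖ ≤ (1 + K) * ‖y - x‖ := by
    rw [← WithLp.toLp_sub, WithLp.prod_norm_eq_of_L2, Prod.mk_sub_mk]
    refine Real.sqrt_le_iff.2 ⟨by positivity, ?_⟩
    have := norm_nonneg (y - x)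
    have h5 := norm_nonneg (f y - f x)
    have hK0 : (0 : ℝ) ≤ K := K.2
    change ‖y - x‖ ^ 2 + ‖f y - f x‖ ^ 2 ≤ _
    nlinarith [mul_self_le_mul_self h5 h3, mul_nonneg hK0 (mul_self_nonneg ‖y - x‖)]
  have h5 : ε / (1 + K) * ‖WithLp.toLp 2 (y, f y) - WithLp.toLp 2 (x, f x)‖ ≤ ε * ‖y - x‖ := by
    refine (mul_le_mul_of_nonneg_left h4 (by positivity)).trans_eq ?_
    field_simp
  simp only [WithLp.prod_inner_apply, WithLp.ofLp_sub, Prod.fst_sub, Prod.snd_sub] at h1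
  simp only [RCLike.inner_apply, conj_trivial] at h1
  linarith

section Smooth

variable [CompleteSpace E]

/-- The slope of `f` in each direction `h` dominates `⟪v, h⟫`; the choice `h = v - ∇ f x` forces
equality. -/
theorem eq_gradient_of_mem_regularSubdifferential {f : E → ℝ} {x v : E}
    (hf : DifferentiableAt ℝ f x) (hv : v ∈ regularSubdifferential f x) : v = ∇ f x := by
  have key : ∀ h : E, inner ℝ v h ≤ inner ℝ (∇ f x) h := by
    intro h
    refine le_of_eventually_mul_le (c := 2 * ‖h‖) fun ε hε => ?_
    have ht := tendsto_add_smul_nhdsWithin_zero x h (Set.Ioi 0)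
    filter_upwards [ht.eventually (hv ε hε),
      ht.eventually (hasGradientAt_iff_isLittleO.1 hf.hasGradientAt |>.def hε),
      self_mem_nhdsWithin] with t h1 h2 h3
    have h3' : 0 < t := h3
    simp only [add_sub_cancel_left, norm_smul, Real.norm_of_nonneg h3'.le,
      inner_smul_right] at h1 h2
    have := (le_abs_self _).trans h2
    linarith
  have h0 := key (v - ∇ f x)
  rw [← sub_nonpos, ← inner_sub_left] at h0
  rw [real_inner_self_eq_norm_sq] at h0
  exact sub_eq_zero.1 (norm_eq_zero.1 (pow_eq_zero_iff two_ne_zero |>.1 (h0.antisymm (sq_nonneg _))))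

theorem gradient_mem_regularSubdifferential {f : E → ℝ} {x : E} (hf : DifferentiableAt ℝ f x) :
    ∇ f x ∈ regularSubdifferential f x := by
  intro ε hε
  filter_upwards [hasGradientAt_iff_isLittleO.1 hf.hasGradientAt |>.def hε] with y hy
  have := (neg_abs_le _).trans' (neg_le_neg hy)
  linarith

theorem IsContinuouslyDifferentiableAt.subdifferential_eq {f : E → ℝ} {x : E}
    (hf : IsContinuouslyDifferentiableAt f x) : subdifferential f x = {∇ f x} := by
  refine Set.Subset.antisymm ?_ ?_
  · rintro v ⟨xs, vs, hvs, hxs, -, hlim⟩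
    refine tendsto_nhds_unique (hlim.congr' ?_) (hf.2.tendsto.comp hxs)
    filter_upwards [hxs.eventually hf.1] with i hi
    exact eq_gradient_of_mem_regularSubdifferential hi (hvs i)
  · rintro _ rfl
    exact regularSubdifferential_subset_subdifferential _ _
      (gradient_mem_regularSubdifferential hf.1.self_of_nhds)

/-- Continuity of the gradient at the single point `x` already gives strict differentiability there.
-/
theorem IsContinuouslyDifferentiableAt.isLocallyLipschitzAt {f : E → ℝ} {x : E}
    (hf : IsContinuouslyDifferentiableAt f x) : IsLocallyLipschitzAt f x := by
  have h : HasStrictFDerivAt f (InnerProductSpace.toDual ℝ E (∇ f x)) x :=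
    hasStrictFDerivAt_of_hasFDerivAt_of_continuousAt
      (f' := fun y => InnerProductSpace.toDual ℝ E (∇ f y))
      (hf.1.mono fun y hy => hy.hasGradientAt.hasFDerivAt)
      ((InnerProductSpace.toDual ℝ E).continuous.continuousAt.comp hf.2)
  obtain ⟨K, s, hs, hK⟩ := h.exists_lipschitzOnWith
  exact ⟨K, s, hs, hK⟩

end Smooth

end Sub

/-! ### Mean value inequality and uniform descent. -/

section MeanValue

variable {E : Type*} [NormedAddCommGroup E] [InnerProductSpace ℝ E]

/-- A minimizer of `f + M ‖· - y‖²` carries the regular subgradient `2 M (y - u)`. -/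
theorem smul_sub_mem_regularSubdifferential {f : E → ℝ} {M : ℝ} (hM : 0 < M) {y u : E}
    (hmin : ∀ᶠ z in 𝓝 u, f u + M * ‖u - y‖ ^ 2 ≤ f z + M * ‖z - y‖ ^ 2) :
    (2 * M) • (y - u) ∈ regularSubdifferential f u := by
  intro ε hε
  -- Within radius `ε / M` the remainder `M * ‖z - u‖ ^ 2` is absorbed by `ε * ‖z - u‖`.
  filter_upwards [hmin, Metric.ball_mem_nhds u (div_pos hε hM)] with z h1 h2
  rw [mem_ball_iff_norm, lt_div_iff₀ hM] at h2
  have e : ‖z - y‖ ^ 2 = ‖u - y‖ ^ 2 - 2 * inner ℝ (y - u) (z - u) + ‖z - u‖ ^ 2 := by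
    have : z - y = (u - y) + (z - u) := by abel
    rw [this, norm_add_sq_real, ← neg_sub y u, inner_neg_left, norm_neg]
    ring
  rw [e] at h1
  rw [real_inner_smul_left]
  nlinarith [mul_le_mul_of_nonneg_right h2.le (norm_nonneg (z - u))]

/-- Comparing a minimizer `u` with the competitor `y` gives `M * ‖u - y‖ ^ 2 ≤ K * ‖u - y‖`. So `‖u
- y‖ < r / 2` and `u` is interior, where the first-order condition is available. -/
theorem exists_minimizer_add_sq {E : Type*} [NormedAddCommGroup E] [ProperSpace E]
    {f : E → ℝ} {K : ℝ≥0} {x y : E} {r M : ℝ}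
    (hr : 0 < r) (hM : 0 < M) (hKM : 2 * K < M * r)
    (hf : LipschitzOnWith K f (Metric.closedBall x r)) (hy : ‖y - x‖ ≤ r / 2) :
    ∃ u ∈ Metric.ball x r, M * ‖u - y‖ ≤ K ∧
      ∀ z ∈ Metric.closedBall x r, f u + M * ‖u - y‖ ^ 2 ≤ f z + M * ‖z - y‖ ^ 2 := by
  have hyB : y ∈ Metric.closedBall x r := by
    rw [mem_closedBall_iff_norm]; linarith
  obtain ⟨u, hu, hmin⟩ := (isCompact_closedBall x r).exists_isMinOn ⟨y, hyB⟩
    (f := fun z => f z + M * ‖z - y‖ ^ 2) (hf.continuousOn.add (by fun_prop))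
  have hmin' : ∀ z ∈ Metric.closedBall x r, f u + M * ‖u - y‖ ^ 2 ≤ f z + M * ‖z - y‖ ^ 2 :=
    fun z hz => hmin hz
  have h1 := hmin' y hyB
  have h2 := (le_abs_self _).trans ((Real.dist_eq _ _).symm.le.trans (hf.dist_le_mul y hyB u hu))
  rw [dist_comm, dist_eq_norm] at h2
  have h3 : M * ‖u - y‖ ≤ K := by
    rcases (norm_nonneg (u - y)).eq_or_lt with h0 | h0
    · rw [← h0, mul_zero]; exact K.2
    · refine le_of_mul_le_mul_right ?_ h0
      simp only [sub_self, norm_zero] at h1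
      nlinarith
  refine ⟨u, ?_, h3, hmin'⟩
  rw [mem_ball_iff_norm]
  have h4 : ‖u - y‖ < r / 2 := by
    by_contra! hc
    nlinarith [mul_le_mul_of_nonneg_left hc hM.le]
  linarith [norm_sub_le_norm_sub_add_norm_sub u y x]

/-- A mean value inequality for the inf-convolution of `f` with `M ‖·‖²`, read off at the ends of
a segment, where the inf-convolution differs from `f` by at most `K² / M`. -/
theorem le_add_of_inner_le_of_quadratic [ProperSpace E] {f : E → ℝ} {K : ℝ≥0} {x y w : E}
    {r M a t : ℝ} (hr : 0 < r) (hM : 0 < M) (hKM : 2 * K < M * r)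
    (hf : LipschitzOnWith K f (Metric.closedBall x r))
    (ha : ∀ u ∈ Metric.ball x r, ∀ v ∈ regularSubdifferential f u, inner ℝ v w ≤ a)
    (ht : 0 ≤ t) (hy : ‖y - x‖ ≤ r / 4) (htw : t * ‖w‖ ≤ r / 4) :
    f (y + t • w) ≤ f y + a * t + K ^ 2 / M := by
  have hex : ∀ z, ∃ u, ‖z - x‖ ≤ r / 2 → u ∈ Metric.ball x r ∧ M * ‖u - z‖ ≤ K ∧
      ∀ z' ∈ Metric.closedBall x r, f u + M * ‖u - z‖ ^ 2 ≤ f z' + M * ‖z' - z‖ ^ 2 := by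
    intro z
    by_cases hz : ‖z - x‖ ≤ r / 2
    · obtain ⟨u, h1, h2, h3⟩ := exists_minimizer_add_sq hr hM hKM hf hz
      exact ⟨u, fun _ => ⟨h1, h2, h3⟩⟩
    · exact ⟨0, fun h => absurd h hz⟩
  choose u hu using hex
  let g : E → ℝ := fun z => f (u z) + M * ‖u z - z‖ ^ 2
  -- The old minimizer `u z` is a competitor at `z + s • w`. The linear term of the expanded square
  -- is the pairing of `w` with the regular subgradient at `u z`, so only an error quadratic in `s`
  -- remains.
  have step : ∀ z s, 0 ≤ s → ‖z - x‖ ≤ r / 2 → ‖z + s • w - x‖ ≤ r / 2 →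
      g (z + s • w) ≤ g z + (a * s + M * s ^ 2 * ‖w‖ ^ 2) := by
    intro z s hs hz hz'
    obtain ⟨h1, -, h3⟩ := hu z hz
    have hv := ha _ h1 _ (smul_sub_mem_regularSubdifferential hM (y := z)
      ((Metric.isOpen_ball.eventually_mem h1).mono
        fun z' hz' => h3 z' (Metric.ball_subset_closedBall hz')))
    have h4 := (hu _ hz').2.2 (u z) (Metric.ball_subset_closedBall h1)
    have e : ‖u z - (z + s • w)‖ ^ 2 =
        ‖u z - z‖ ^ 2 + 2 * s * inner ℝ (z - u z) w + s ^ 2 * ‖w‖ ^ 2 := by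
      have : u z - (z + s • w) = -(z - u z) - s • w := by abel
      rw [this, norm_sub_sq_real, inner_neg_left, norm_neg, inner_smul_right, norm_smul, mul_pow,
        Real.norm_eq_abs, sq_abs, norm_sub_rev]
      ring
    rw [e] at h4
    rw [real_inner_smul_left] at hv
    simp only [g]
    nlinarith [mul_le_mul_of_nonneg_left hv hs]
  have hseg : ∀ s, 0 ≤ s → s ≤ t → ‖y + s • w - x‖ ≤ r / 2 := by
    intro s hs hst
    have h1 : ‖y + s • w - x‖ ≤ ‖y - x‖ + ‖s • w‖ := by
      rw [add_sub_right_comm]; exact norm_add_le _ _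
    rw [norm_smul, Real.norm_of_nonneg hs] at h1
    linarith [mul_le_mul_of_nonneg_right hst (norm_nonneg w)]
  -- Cutting the segment into `N + 1` equal steps divides the total quadratic error by `N + 1`.
  have hsub : ∀ N : ℕ, g (y + t • w) ≤ g y + a * t + M * t ^ 2 * ‖w‖ ^ 2 * (1 / ((N : ℝ) + 1)) := by
    intro N
    have hN : (0 : ℝ) < N + 1 := by positivity
    set s : ℝ := t / (N + 1) with hs
    have hs0 : 0 ≤ s := by positivity
    have hst : (N + 1) * s = t := by rw [hs]; field_simp
    have ind : ∀ k : ℕ, k ≤ N + 1 →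
        g (y + (k * s) • w) ≤ g y + k * (a * s + M * s ^ 2 * ‖w‖ ^ 2) := by
      intro k
      induction k with
      | zero => intro _; simp
      | succ k ih =>
        intro hk
        have hk' : ((k : ℝ) + 1) ≤ N + 1 := by exact_mod_cast hk
        have h1 := step (y + (k * s) • w) s hs0
          (hseg _ (by positivity) (by nlinarith))
          (by rw [add_assoc, ← add_smul]; exact hseg _ (by positivity) (by nlinarith))
        rw [add_assoc, ← add_smul] at h1
        have h2 := ih (by omega)
        push_cast
        rw [add_mul (k : ℝ) 1 s, one_mul]
        linarith
    have h := ind (N + 1) le_rfl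
    push_cast at h
    rw [hst] at h
    refine h.trans_eq ?_
    rw [hs]
    field_simp
    ring
  have hlim : Tendsto (fun N : ℕ => g y + a * t + M * t ^ 2 * ‖w‖ ^ 2 * (1 / ((N : ℝ) + 1)))
      atTop (𝓝 (g y + a * t)) := by
    simpa using (tendsto_one_div_add_atTop_nhds_zero_nat.const_mul
      (M * t ^ 2 * ‖w‖ ^ 2)).const_add (g y + a * t)
  have hg : g (y + t • w) ≤ g y + a * t := ge_of_tendsto' hlim hsub
  have hyB : ‖y - x‖ ≤ r / 2 := by linarith
  have hgy : g y ≤ f y := by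
    have := (hu y hyB).2.2 y (by rw [mem_closedBall_iff_norm]; linarith)
    simpa [g] using this
  have hend := hseg t ht le_rfl
  obtain ⟨h1, h2, -⟩ := hu _ hend
  have h3 := (le_abs_self _).trans ((Real.dist_eq _ _).symm.le.trans (hf.dist_le_mul (y + t • w)
    (by rw [mem_closedBall_iff_norm]; linarith) _ (Metric.ball_subset_closedBall h1)))
  rw [dist_comm, dist_eq_norm] at h3
  have h4 : K * ‖u (y + t • w) - (y + t • w)‖ ≤ (K : ℝ) ^ 2 / M := by
    rw [le_div_iff₀ hM]
    nlinarith [mul_le_mul_of_nonneg_left h2 K.2]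
  have h5 : f (u (y + t • w)) ≤ g (y + t • w) := le_add_of_nonneg_right (by positivity)
  linarith

theorem le_add_mul_of_inner_le [ProperSpace E] {f : E → ℝ} {K : ℝ≥0} {x y w : E}
    {r a t : ℝ} (hr : 0 < r)
    (hf : LipschitzOnWith K f (Metric.closedBall x r))
    (ha : ∀ u ∈ Metric.ball x r, ∀ v ∈ regularSubdifferential f u, inner ℝ v w ≤ a)
    (ht : 0 ≤ t) (hy : ‖y - x‖ ≤ r / 4) (htw : t * ‖w‖ ≤ r / 4) :
    f (y + t • w) ≤ f y + a * t := by
  have hlim : Tendsto (fun M : ℝ => f y + a * t + (K : ℝ) ^ 2 / M) atTop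
      (𝓝 (f y + a * t)) := by
    simpa using (tendsto_const_nhds.div_atTop tendsto_id).const_add (f y + a * t)
  refine ge_of_tendsto hlim ?_
  filter_upwards [eventually_gt_atTop 0, eventually_gt_atTop (2 * K / r)] with M h1 h2
  exact le_add_of_inner_le_of_quadratic hr h1 (by rwa [div_lt_iff₀ hr] at h2) hf ha ht hy htw

/-- Strict inequalities against all subgradients at `x` persist for regular subgradients nearby. -/
theorem eventually_inner_lt_of_subdifferential [ProperSpace E] {f : E → ℝ} {x w : E} {a : ℝ}
    (hf : IsLocallyLipschitzAt f x) (ha : ∀ v ∈ subdifferential f x, inner ℝ v w < a) :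
    ∀ᶠ u in 𝓝 x, ∀ v ∈ regularSubdifferential f u, inner ℝ v w < a := by
  by_contra hc
  have hcont := hf.continuousAt
  obtain ⟨K, U, hU, hK⟩ := hf
  -- Keeping `U` a neighbourhood of each chosen point bounds the violating subgradients by `K`, so a
  -- subsequence converges to a subgradient at `x`.
  have hfr := (not_eventually.1 hc).and_eventually (eventually_eventually_nhds.2 hU)
  obtain ⟨xs, hxs, h⟩ := exists_seq_forall_of_frequently hfr
  push Not at h
  choose h1 h2 using h
  choose vs hvs hva using h1
  have hbd : ∀ i, vs i ∈ Metric.closedBall (0 : E) K := fun i => by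
    rw [mem_closedBall_zero_iff]
    exact norm_le_of_mem_regularSubdifferential hK (h2 i) (hvs i)
  obtain ⟨v, -, φ, hφ, hv⟩ := (isCompact_closedBall (0 : E) K).tendsto_subseq hbd
  have hx' := hxs.comp hφ.tendsto_atTop
  have hmem : v ∈ subdifferential f x :=
    ⟨xs ∘ φ, vs ∘ φ, fun i => hvs _, hx', hcont.tendsto.comp hx', hv⟩
  exact (ha v hmem).not_ge
    (ge_of_tendsto' (hv.inner tendsto_const_nhds) fun i => hva (φ i))

theorem eventually_le_add_mul_of_subdifferential [ProperSpace E] {f : E → ℝ} {x w : E} {a : ℝ}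
    (hf : IsLocallyLipschitzAt f x) (ha : ∀ v ∈ subdifferential f x, inner ℝ v w < a) :
    ∀ᶠ p : E × ℝ in 𝓝 x ×ˢ 𝓝[>] 0, f (p.1 + p.2 • w) ≤ f p.1 + a * p.2 := by
  have hev := eventually_inner_lt_of_subdifferential hf ha
  obtain ⟨K, U, hU, hK⟩ := hf
  obtain ⟨r, hr, hrU⟩ := Metric.nhds_basis_closedBall.mem_iff.1 (inter_mem hU hev)
  have h1 : ∀ᶠ y in 𝓝 x, ‖y - x‖ ≤ r / 4 := by
    filter_upwards [Metric.closedBall_mem_nhds x (by positivity : 0 < r / 4)] with y hy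
    rwa [mem_closedBall_iff_norm] at hy
  have h2 : ∀ᶠ t : ℝ in 𝓝[>] 0, t * ‖w‖ ≤ r / 4 := by
    have : Tendsto (fun t : ℝ => t * ‖w‖) (𝓝 0) (𝓝 (0 * ‖w‖)) :=
      Continuous.tendsto (by fun_prop) 0
    rw [zero_mul] at this
    exact (this.mono_left nhdsWithin_le_nhds).eventually_le_const (by positivity)
  filter_upwards [h1.prod_mk (h2.and self_mem_nhdsWithin)] with p hp
  exact le_add_mul_of_inner_le hr (hK.mono fun u hu => (hrU hu).1)
    (fun u hu v hv => ((hrU (Metric.ball_subset_closedBall hu)).2 v hv).le)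
    (le_of_lt hp.2.2) hp.1 hp.2.1

/-- With no subgradients the descent estimate holds vacuously for `w = 0` and `a = -1`, which is
absurd. -/
theorem subdifferential_nonempty [ProperSpace E] {f : E → ℝ} {x : E}
    (hf : IsLocallyLipschitzAt f x) : (subdifferential f x).Nonempty := by
  by_contra! hc
  have h := eventually_le_add_mul_of_subdifferential (w := 0) (a := -1) hf (by simp [hc])
  have h' := h.and (tendsto_snd.eventually self_mem_nhdsWithin)
  obtain ⟨p, h1, h2⟩ := h'.exists
  have h2' : 0 < p.2 := h2
  simp only [smul_zero, add_zero] at h1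
  linarith

end MeanValue

/-! ### Tangent cones, polarity and Clarke regularity. -/

section Cones

variable {E : Type*} [NormedAddCommGroup E] [InnerProductSpace ℝ E]

theorem mem_tangentCone_of_forall_exists {C : Set E} {x z : E}
    (h : ∀ ε : ℝ, 0 < ε → ∃ t : ℝ, 0 < t ∧ t < ε ∧ ∃ u : E, x + t • u ∈ C ∧ ‖u - z‖ < ε) :
    z ∈ tangentCone C x := by
  have hpos : ∀ i : ℕ, (0 : ℝ) < 1 / ((i : ℝ) + 1) := fun i => by positivity
  choose t ht0 ht u hu huz using fun i : ℕ => h _ (hpos i)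
  have htlim : Tendsto t atTop (𝓝 0) :=
    squeeze_zero (fun i => (ht0 i).le) (fun i => (ht i).le) tendsto_one_div_add_atTop_nhds_zero_nat
  have hulim : Tendsto u atTop (𝓝 z) := by
    rw [tendsto_iff_norm_sub_tendsto_zero]
    exact squeeze_zero (fun i => norm_nonneg _) (fun i => (huz i).le)
      tendsto_one_div_add_atTop_nhds_zero_nat
  refine ⟨fun i => x + t i • u i, t, hu, ht0, htlim, ?_, ?_⟩
  · simpa using (htlim.smul hulim).const_add x
  · refine hulim.congr fun i => ?_
    rw [add_sub_cancel_left, inv_smul_smul₀ (ht0 i).ne']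

/-- Vectors polar to the contingent cone are regular normals in finite dimension. -/
theorem mem_regularNormalCone_of_polar [ProperSpace E] {C : Set E} {x v : E} (hx : x ∈ C)
    (hv : ∀ z ∈ tangentCone C x, inner ℝ v z ≤ 0) : v ∈ regularNormalCone C x := by
  refine ⟨hx, fun ε hε => ?_⟩
  by_contra hc
  -- The unit directions towards violating points accumulate at a tangent `z` with `⟪v, z⟫ ≥ ε`.
  obtain ⟨xs, hxs, h⟩ := exists_seq_forall_of_frequently
    ((not_eventually.1 hc).and_eventually self_mem_nhdsWithin)
  have hxs' : Tendsto xs atTop (𝓝 x) := hxs.mono_right nhdsWithin_le_nhds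
  have hpos : ∀ i, 0 < ‖xs i - x‖ := fun i => by
    rw [norm_pos_iff]
    intro h0
    have := (h i).1
    rw [h0] at this
    simp at this
  have hball : ∀ i, ‖xs i - x‖⁻¹ • (xs i - x) ∈ Metric.closedBall (0 : E) 1 := fun i => by
    rw [mem_closedBall_zero_iff, norm_smul, norm_inv, norm_norm, inv_mul_cancel₀ (hpos i).ne']
  obtain ⟨z, -, φ, hφ, hz⟩ := (isCompact_closedBall (0 : E) 1).tendsto_subseq hball
  have hx2 := hxs'.comp hφ.tendsto_atTop
  have hmem : z ∈ tangentCone C x :=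
    ⟨xs ∘ φ, fun i => ‖xs (φ i) - x‖, fun i => (h _).2, fun i => hpos _,
      (tendsto_iff_norm_sub_tendsto_zero.1 hx2), hx2, hz⟩
  have hge : ε ≤ inner ℝ v z := by
    refine ge_of_tendsto' (tendsto_const_nhds.inner hz) fun i => ?_
    have h1 := not_le.1 (h (φ i)).1
    simp only [Function.comp, inner_smul_right]
    rw [inv_mul_eq_div, le_div_iff₀ (hpos _)]
    exact h1.le
  linarith [hv z hmem]

theorem inner_nonpos_of_mem_regularNormalCone {C : Set E} {x v w : E}
    (hv : v ∈ regularNormalCone C x) (hw : ∀ᶠ t : ℝ in 𝓝[>] 0, x + t • w ∈ C) :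
    inner ℝ v w ≤ 0 := by
  refine le_of_eventually_mul_le (c := ‖w‖) fun ε hε => ?_
  have ht : Tendsto (fun t : ℝ => x + t • w) (𝓝[>] 0) (𝓝[C] x) :=
    tendsto_nhdsWithin_iff.2 ⟨tendsto_add_smul_nhdsWithin_zero x w _, hw⟩
  filter_upwards [ht.eventually (hv.2 ε hε), self_mem_nhdsWithin] with t h1 h2
  have h2' : 0 < t := h2
  simp only [add_sub_cancel_left, norm_smul, Real.norm_of_nonneg h2'.le, inner_smul_right] at h1
  linarith

/-- Since `x` maximizes `f` over `C`, difference quotients along a tangent sequence are nonpositive.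
-/
theorem inner_nonpos_of_mem_tangentCone {f : E → ℝ} {C : Set E} {x v z : E}
    (hC : ∀ y ∈ C, f y ≤ f x) (hv : v ∈ regularSubdifferential f x)
    (hz : z ∈ tangentCone C x) : inner ℝ v z ≤ 0 := by
  obtain ⟨xs, t, hxs, ht, -, hlim, hz⟩ := hz
  have key : ∀ ε : ℝ, 0 < ε → inner ℝ v z ≤ ε * ‖z‖ := by
    intro ε hε
    refine le_of_tendsto_of_tendsto (tendsto_const_nhds.inner hz) (hz.norm.const_mul ε) ?_
    filter_upwards [hlim.eventually (hv ε hε)] with i hi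
    have h1 := hC _ (hxs i)
    have hti := inv_pos.2 (ht i)
    rw [inner_smul_right, norm_smul, Real.norm_of_nonneg hti.le, mul_left_comm]
    exact mul_le_mul_of_nonneg_left (by linarith) hti.le
  have := le_of_eventually_mul_le (a := inner ℝ v z) (b := 0) (c := ‖z‖) fun ε hε => by
    filter_upwards [self_mem_nhdsWithin] with t h2
    have h2' : 0 < t := h2
    nlinarith [mul_le_mul_of_nonneg_left (key ε hε) h2'.le]
  exact this

/-- If near `x` the set `C` is mapped into itself along all strictly feasible directions, then the
linearized cone is the tangent cone, and `C` is Clarke regular. -/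
theorem isClarkeRegularAt_and_tangentCone_eq [ProperSpace E] {C L : Set E} {x w : E} (hx : x ∈ C)
    (hTL : tangentCone C x ⊆ L)
    (hLw : ∀ z ∈ L, ∀ η : ℝ, 0 < η →
      ∀ᶠ p : E × ℝ in 𝓝 x ×ˢ 𝓝[>] 0, p.1 ∈ C → p.1 + p.2 • (z + η • w) ∈ C) :
    IsClarkeRegularAt C x ∧ tangentCone C x = L := by
  have hlimη : ∀ z : E, Tendsto (fun η : ℝ => z + η • w) (𝓝[>] 0) (𝓝 z) :=
    fun z => tendsto_add_smul_nhdsWithin_zero z w _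
  refine ⟨Set.Subset.antisymm ?_ (regularNormalCone_subset_normalCone C x),
    hTL.antisymm fun z hz => mem_tangentCone_of_forall_exists fun ε hε => ?_⟩
  · rintro v ⟨xs, vs, hvs, hxs, hvlim⟩
    refine mem_regularNormalCone_of_polar hx fun z hz => ?_
    refine le_of_tendsto (tendsto_const_nhds.inner (hlimη z)) ?_
    filter_upwards [self_mem_nhdsWithin] with η hη
    refine le_of_tendsto (hvlim.inner tendsto_const_nhds) ?_
    -- The invariance is uniform in the base point, so it applies at `xs i` and not only at `x`.
    filter_upwards [hxs.eventually (hLw z (hTL hz) η hη).curry] with i hi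
    exact inner_nonpos_of_mem_regularNormalCone (hvs i) (hi.mono fun t ht => ht (hvs i).1)
  · have hz1 : ∀ᶠ η : ℝ in 𝓝[>] 0, ‖z + η • w - z‖ < ε :=
      ((hlimη z).eventually (Metric.ball_mem_nhds z hε)).mono fun η h => mem_ball_iff_norm.1 h
    obtain ⟨η, h1, h2⟩ := (hz1.and self_mem_nhdsWithin).exists
    obtain ⟨t, ⟨h3, h4⟩, h5⟩ := (((hLw z hz η h2).curry.self_of_nhds.and
      self_mem_nhdsWithin).and (nhdsWithin_le_nhds (Iio_mem_nhds hε))).exists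
    exact ⟨t, h4, h5, z + η • w, h3 hx, h1⟩

end Cones

/-! ### Constraint qualifications and the feasible set. -/

section Constraints

variable {E : Type*} [NormedAddCommGroup E] [InnerProductSpace ℝ E] {J : Type*}

theorem convex_setOf_sum_smul {s : Finset J} {D : J → Set E} (hD : ∀ j ∈ s, Convex ℝ (D j)) :
    Convex ℝ {u | ∃ (c : J → ℝ) (v : J → E), (∀ j ∈ s, 0 ≤ c j) ∧ ∑ j ∈ s, c j = 1 ∧
      (∀ j ∈ s, v j ∈ D j) ∧ ∑ j ∈ s, c j • v j = u} := by
  rintro _ ⟨c, v, hc, hc1, hv, rfl⟩ _ ⟨c', v', hc', hc1', hv', rfl⟩ a b ha hb hab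
  have hex : ∀ j, ∃ u, j ∈ s → u ∈ D j ∧
      (a * c j + b * c' j) • u = a • c j • v j + b • c' j • v' j := by
    intro j
    by_cases hj : j ∈ s
    · have h1 : 0 ≤ a * c j := mul_nonneg ha (hc j hj)
      have h2 : 0 ≤ b * c' j := mul_nonneg hb (hc' j hj)
      rcases (add_nonneg h1 h2).eq_or_lt with h0 | h0
      · have h3 : a * c j = 0 := by linarith
        have h4 : b * c' j = 0 := by linarith
        exact ⟨v j, fun _ => ⟨hv j hj, by simp [smul_smul, h3, h4]⟩⟩
      · refine ⟨_, fun _ => ⟨hD j hj (hv j hj) (hv' j hj) (div_nonneg h1 h0.le)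
          (div_nonneg h2 h0.le) (by rw [← add_div, div_self h0.ne']), ?_⟩⟩
        rw [smul_add, smul_smul, smul_smul, mul_div_cancel₀ _ h0.ne', mul_div_cancel₀ _ h0.ne',
          mul_smul, mul_smul]
    · exact ⟨0, fun h => absurd h hj⟩
  choose u hu using hex
  refine ⟨fun j => a * c j + b * c' j, u, fun j hj =>
    add_nonneg (mul_nonneg ha (hc j hj)) (mul_nonneg hb (hc' j hj)), ?_,
    fun j hj => (hu j hj).1, ?_⟩
  · rw [Finset.sum_add_distrib, ← Finset.mul_sum, ← Finset.mul_sum, hc1, hc1']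
    linarith
  · rw [Finset.sum_congr rfl fun j hj => (hu j hj).2, Finset.sum_add_distrib, Finset.smul_sum,
      Finset.smul_sum]

/-- This is a continuous image of a simplex times the product of the `D j`, both indexed by the
subtype `s` because values off `s` are unconstrained. -/
theorem isCompact_setOf_sum_smul {s : Finset J} {D : J → Set E} (hD : ∀ j ∈ s, IsCompact (D j)) :
    IsCompact {u | ∃ (c : J → ℝ) (v : J → E), (∀ j ∈ s, 0 ≤ c j) ∧ ∑ j ∈ s, c j = 1 ∧
      (∀ j ∈ s, v j ∈ D j) ∧ ∑ j ∈ s, c j • v j = u} := by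
  classical
  have hK : IsCompact (stdSimplex ℝ s ×ˢ Set.univ.pi fun j : s => D j) :=
    (isCompact_stdSimplex ℝ s).prod (isCompact_univ_pi fun j => hD j j.2)
  convert hK.image (f := fun p : (s → ℝ) × (s → E) => ∑ j, p.1 j • p.2 j) (by fun_prop) using 1
  ext u
  constructor
  · rintro ⟨c, v, hc, hc1, hv, rfl⟩
    refine ⟨⟨fun j => c j, fun j => v j⟩, ⟨⟨fun j => hc j j.2, ?_⟩, fun j _ => hv j j.2⟩, ?_⟩
    · exact (Finset.sum_coe_sort s c).trans hc1
    · exact Finset.sum_coe_sort s fun j => c j • v j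
  · rintro ⟨⟨c, v⟩, ⟨⟨hc, hc1⟩, hv⟩, rfl⟩
    refine ⟨fun j => if h : j ∈ s then c ⟨j, h⟩ else 0, fun j => if h : j ∈ s then v ⟨j, h⟩ else 0,
      fun j hj => by simpa [hj] using hc ⟨j, hj⟩, ?_,
      fun j hj => by simpa [hj] using hv ⟨j, hj⟩ trivial, ?_⟩
    · rw [← hc1, ← Finset.sum_coe_sort s]
      exact Finset.sum_congr rfl fun j _ => by simp
    · rw [← Finset.sum_coe_sort s]
      exact Finset.sum_congr rfl fun j _ => by simp

/-- Positive linear independence of compact convex sets yields a common descent direction. -/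
theorem exists_inner_neg_of_positivelyIndependent [CompleteSpace E] {s : Finset J} {D : J → Set E}
    (hconv : ∀ j ∈ s, Convex ℝ (D j)) (hcomp : ∀ j ∈ s, IsCompact (D j))
    (hne : ∀ j ∈ s, (D j).Nonempty)
    (hind : ∀ (c : J → ℝ) (v : J → E), (∀ j ∈ s, v j ∈ D j) → (∀ j ∈ s, 0 ≤ c j) →
      ∑ j ∈ s, c j • v j = 0 → ∀ j ∈ s, c j = 0) :
    ∃ w : E, ∀ j ∈ s, ∀ v ∈ D j, inner ℝ v w < 0 := by
  classical
  let S : Set E := {u | ∃ (c : J → ℝ) (v : J → E), (∀ j ∈ s, 0 ≤ c j) ∧ ∑ j ∈ s, c j = 1 ∧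
      (∀ j ∈ s, v j ∈ D j) ∧ ∑ j ∈ s, c j • v j = u}
  have h0 : (0 : E) ∉ S := by
    rintro ⟨c, v, hc, hc1, hv, h⟩
    rw [Finset.sum_eq_zero (hind c v hv hc h)] at hc1
    exact zero_ne_one hc1
  obtain ⟨l, a, hl0, hl⟩ := geometric_hahn_banach_point_closed (convex_setOf_sum_smul hconv)
    (isCompact_setOf_sum_smul hcomp).isClosed h0
  rw [map_zero] at hl0
  refine ⟨-(InnerProductSpace.toDual ℝ E).symm l, fun j hj v hv => ?_⟩
  have hmem : v ∈ S := by
    have hex : ∀ i, ∃ u, i ∈ s → u ∈ D i := fun i => by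
      by_cases hi : i ∈ s
      · exact (hne i hi).imp fun u hu _ => hu
      · exact ⟨0, fun h => absurd h hi⟩
    choose u hu using hex
    -- All the weight goes to `v`, but the other slots must still hold points of `D i`, whence
    -- `hne`.
    refine ⟨Pi.single j 1, Function.update u j v, fun i _ => ?_, ?_, fun i hi => ?_, ?_⟩
    · by_cases h : i = j
      · subst h; simp
      · simp [h]
    · rw [Finset.sum_eq_single_of_mem j hj fun i _ h => by simp [h]]
      simp
    · by_cases h : i = j
      · subst h; simpa using hv
      · simpa [h] using hu i hi
    · rw [Finset.sum_eq_single_of_mem j hj fun i _ h => by simp [h]]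
      simp
  have h2 := hl v hmem
  rw [inner_neg_right, real_inner_comm, InnerProductSpace.toDual_symm_apply]
  linarith

variable [Fintype J]

theorem mem_activeIndices {E : Type*} {J : Type*} [Fintype J] {f : J → E → ℝ} {x : E} {j : J} :
    j ∈ activeIndices f x ↔ f j x = 0 := by
  simp [activeIndices]

/-- A direction of strict descent for the active constraints keeps feasible points feasible. -/
theorem eventually_add_smul_mem_feasibleSet [ProperSpace E] {f : J → E → ℝ} {x w : E}
    (hx : x ∈ feasibleSet f) (hcont : ∀ j, ContinuousAt (f j) x)
    (hlip : ∀ j ∈ activeIndices f x, IsLocallyLipschitzAt (f j) x)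
    (hw : ∀ j ∈ activeIndices f x, ∀ v ∈ subdifferential (f j) x, inner ℝ v w < 0) :
    ∀ᶠ p : E × ℝ in 𝓝 x ×ˢ 𝓝[>] 0, p.1 ∈ feasibleSet f → p.1 + p.2 • w ∈ feasibleSet f := by
  have h : ∀ j, ∀ᶠ p : E × ℝ in 𝓝 x ×ˢ 𝓝[>] 0,
      p.1 ∈ feasibleSet f → f j (p.1 + p.2 • w) ≤ 0 := by
    intro j
    by_cases hj : j ∈ activeIndices f x
    · filter_upwards [eventually_le_add_mul_of_subdifferential (hlip j hj) (hw j hj)] with p h1 h2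
      linarith [h2 j]
    -- Inactive constraints stay negative near `x` by continuity alone.
    · have hneg : f j x < 0 := lt_of_le_of_ne (hx j) fun h => hj (mem_activeIndices.2 h)
      have hlim : Tendsto (fun p : E × ℝ => p.1 + p.2 • w) (𝓝 x ×ˢ 𝓝[>] 0) (𝓝 x) := by
        have : Tendsto (fun p : E × ℝ => p.1 + p.2 • w) (𝓝 (x, 0)) (𝓝 (x + (0 : ℝ) • w)) :=
          Continuous.tendsto (by fun_prop) (x, (0 : ℝ))
        rw [zero_smul, add_zero, nhds_prod_eq] at this
        exact this.mono_left (prod_mono le_rfl nhdsWithin_le_nhds)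
      filter_upwards [((hcont j).tendsto.comp hlim).eventually_lt_const hneg] with p h1 _
      exact h1.le
  filter_upwards [eventually_all.2 h] with p hp hpC j
  exact hp j hpC

/-- The nonsmooth Mangasarian-Fromovitz theorem for constraints without irregular subgradients. -/
theorem isClarkeRegularAt_feasibleSet_and_tangentCone_eq [ProperSpace E] [CompleteSpace E]
    {f : J → E → ℝ} {x : E}
    (hx : x ∈ feasibleSet f) (hcont : ∀ j, ContinuousAt (f j) x)
    (hlip : ∀ j ∈ activeIndices f x, IsLocallyLipschitzAt (f j) x)
    (hreg : ∀ j ∈ activeIndices f x, subdifferential (f j) x ⊆ regularSubdifferential (f j) x)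
    (hw : ∃ w : E, ∀ j ∈ activeIndices f x, ∀ v ∈ subdifferential (f j) x, inner ℝ v w < 0) :
    IsClarkeRegularAt (feasibleSet f) x ∧ tangentCone (feasibleSet f) x =
      {z | ∀ j ∈ activeIndices f x, ∀ v ∈ subdifferential (f j) x, inner ℝ v z ≤ 0} := by
  obtain ⟨w, hw⟩ := hw
  refine isClarkeRegularAt_and_tangentCone_eq (w := w) hx ?_ fun z hz η hη =>
    eventually_add_smul_mem_feasibleSet hx hcont hlip fun j hj v hv => ?_
  · intro z hz j hj v hv
    refine inner_nonpos_of_mem_tangentCone (fun y hy => ?_) (hreg j hj hv) hz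
    rw [mem_activeIndices.1 hj]
    exact hy j
  · rw [inner_add_right, inner_smul_right]
    nlinarith [hz j hj v hv, mul_neg_of_pos_of_neg hη (hw j hj v hv)]

/-- A limiting subdifferential need not be convex; `hreg` identifies it with the regular one, which
is closed and convex, and bounded by the Lipschitz constant. -/
theorem NonsmoothMFCQ.exists_inner_neg [ProperSpace E] [CompleteSpace E] {f : J → E → ℝ} {x : E}
    (hlip : ∀ j ∈ activeIndices f x, IsLocallyLipschitzAt (f j) x)
    (hreg : ∀ j ∈ activeIndices f x, subdifferential (f j) x ⊆ regularSubdifferential (f j) x)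
    (hcq : NonsmoothMFCQ f x) :
    ∃ w : E, ∀ j ∈ activeIndices f x, ∀ v ∈ subdifferential (f j) x, inner ℝ v w < 0 := by
  have heq : ∀ j ∈ activeIndices f x,
      subdifferential (f j) x = regularSubdifferential (f j) x := fun j hj =>
    (hreg j hj).antisymm (regularSubdifferential_subset_subdifferential _ _)
  refine exists_inner_neg_of_positivelyIndependent (fun j hj => ?_) (fun j hj => ?_)
    (fun j hj => subdifferential_nonempty (hlip j hj)) hcq
  · rw [heq j hj]
    exact convex_regularSubdifferential _ _
  · rw [heq j hj]
    obtain ⟨K, U, hU, hK⟩ := hlip j hj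
    refine (isCompact_closedBall (0 : E) K).of_isClosed_subset
      (isClosed_regularSubdifferential _ _) fun v hv => ?_
    rw [mem_closedBall_zero_iff]
    exact norm_le_of_mem_regularSubdifferential hK hU hv

end Constraints

theorem proposition3p5 {n : ℕ} {J : Type*} [Fintype J]
    (f : J → EuclideanSpace ℝ (Fin n) → ℝ) (x : EuclideanSpace ℝ (Fin n))
    (hx : x ∈ feasibleSet f) (hcont : ∀ j, ContinuousAt (f j) x) :
    ((∀ j ∈ activeIndices f x, IsContinuouslyDifferentiableAt (f j) x) → MFCQ f x →
      IsClarkeRegularAt (feasibleSet f) x ∧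
      tangentCone (feasibleSet f) x =
        {z | ∀ j ∈ activeIndices f x, inner ℝ (∇ (f j) x) z ≤ 0}) ∧
    ((∀ j ∈ activeIndices f x,
        IsLocallyLipschitzAt (f j) x ∧ IsSubdifferentiallyRegularAt (f j) x) →
      NonsmoothMFCQ f x →
      IsClarkeRegularAt (feasibleSet f) x ∧
      tangentCone (feasibleSet f) x =
        ⋂ j ∈ activeIndices f x, {z | ∀ v ∈ subdifferential (f j) x, inner ℝ v z ≤ 0} ∧
      tangentCone (feasibleSet f) x =
        {z | ∀ v ∈ ⋃ j ∈ activeIndices f x, subdifferential (f j) x, inner ℝ v z ≤ 0}) := by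
  constructor
  · rintro hdiff ⟨w, hw⟩
    have heq := fun j hj => (hdiff j hj).subdifferential_eq
    obtain ⟨h1, h2⟩ := isClarkeRegularAt_feasibleSet_and_tangentCone_eq hx hcont
      (fun j hj => (hdiff j hj).isLocallyLipschitzAt)
      (fun j hj => by
        rw [heq j hj, Set.singleton_subset_iff]
        exact gradient_mem_regularSubdifferential (hdiff j hj).1.self_of_nhds)
      ⟨w, fun j hj v hv => by
        rw [heq j hj, Set.mem_singleton_iff] at hv
        exact hv ▸ hw j hj⟩
    refine ⟨h1, h2.trans (Set.ext fun z => forall₂_congr fun j hj => ?_)⟩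
    rw [heq j hj]
    simp
  · intro h hcq
    have hlip := fun j hj => (h j hj).1
    have hreg := fun j hj => (h j hj).2.subdifferential_subset (h j hj).1
    obtain ⟨h1, h2⟩ := isClarkeRegularAt_feasibleSet_and_tangentCone_eq hx hcont hlip hreg
      (hcq.exists_inner_neg hlip hreg)
    refine ⟨h1, h2.trans ?_, h2.trans ?_⟩
    · ext z
      simp only [Set.mem_iInter, Set.mem_ofPred_eq]
    · ext z
      simp only [Set.mem_iUnion, Set.mem_ofPred_eq]
      exact ⟨fun h v ⟨j, hj, hv⟩ => h j hj v hv, fun h j hj v hv => h v ⟨j, hj, hv⟩⟩
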